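/- Let $\mathbb D=\{z\in\mathbb C:|z|<1\}$ and let $\mathcal S$ be the class of univalent analytic functions $f$ on $\mathbb D$ with $f(0)=0$, $f'(0)=1$; write $f(z)=z+\sum_{n=2}^\infty a_nz^n$. For $0<s\le 1/\sqrt2$ let $\mathcal{ST}_L(s)$ be the class of all $f\in\mathcal S$ such that $zf'(z)/f(z)$ (taken to be $1$ at $z=0$) is subordinate to $\phi(z)=(1+sz)^2$, i.e. equals $\phi(\omega(z))$ on $\mathbb D$ for some analytic $\omega:\mathbb D\to\mathbb D$ with $\omega(0)=0$. Let $0.444981<s\le 1/\sqrt2$ and $h(z)=z\exp\!\left(s\left(2z+\tfrac{s z^2}{2}\right)\right)$. Then $h\in\mathcal{ST}_L(s)$ and $zh'(z)/h(z)=\phi(z)$ on $\mathbb D$. The equation $h(r)+h(-1)=0$ has a root in $(0,1)$, and its smallest root $r_f$ in $(0,1)$ satisfies $0<r_f<1/3$. For every $f\in\mathcal{ST}_L(s)$, $$|z|+\sum_{n=2}^{\infty}|a_n|\,|z|^n\le d\bigl(f(0),\partial f(\mathbb D)\bigr)\qquad\text{for } |z|\le r_f,$$ where $d$ is the Euclidean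 distance. The radius $r_f$ is best possible: for every $r\in(r_f,1)$ there is $f\in\mathcal{ST}_L(s)$ such that the inequality fails for all $z$ with $|z|=r$. -/

import Mathlib

noncomputable section

namespace BohrStarlike

/-- The open unit disk of the complex plane. -/
def disk : Set ℂ := Metric.ball 0 1

/-- The class `𝒮` of normalized univalent functions on the unit disk
(values outside the disk are irrelevant). -/
def classS : Set (ℂ → ℂ) :=
  {f | DifferentiableOn ℂ f disk ∧ Set.InjOn f disk ∧ f 0 = 0 ∧ deriv f 0 = 1}

/-- Subordination `f ≺ g` in the unit disk: `f = g ∘ ω` there, for an analytic self-map `ω` of the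
disk with `ω 0 = 0`. -/
def Subordinate (f g : ℂ → ℂ) : Prop :=
  ∃ ω : ℂ → ℂ, DifferentiableOn ℂ ω disk ∧ Set.MapsTo ω disk disk ∧ ω 0 = 0 ∧
    ∀ z ∈ disk, f z = g (ω z)

/-- The function `z ↦ z f'(z) / f(z)`, with its removable singularity at `0` filled in by the
value `1` (which is the limit for normalized `f`). -/
def logDerivQuot (f : ℂ → ℂ) : ℂ → ℂ :=
  Function.update (fun z => z * deriv f z / f z) 0 1

/-- The Ma-Minda starlike class `𝒮*(φ)`. -/
def starlikeClass (φ : ℂ → ℂ) : Set (ℂ → ℂ) :=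
  {f | f ∈ classS ∧ Subordinate (logDerivQuot f) φ}

/-- The function `φ(z) = (1 + s z)²`. -/
def phiL (s : ℝ) (z : ℂ) : ℂ := (1 + (s : ℂ) * z) ^ 2

/-- The class `𝒮𝒯_L(s) = 𝒮*((1 + s z)²)`. -/
def classSTL (s : ℝ) : Set (ℂ → ℂ) := starlikeClass (phiL s)

/-- The function `h(z) = z exp (s (2 z + s z² / 2))`. -/
def hL (s : ℝ) (z : ℂ) : ℂ :=
  z * Complex.exp ((s : ℂ) * (2 * z + (s : ℂ) * z ^ 2 / 2))

/-- The `n`-th Taylor coefficient of `f` at the origin. -/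
def taylorCoeff (f : ℂ → ℂ) (n : ℕ) : ℂ := iteratedDeriv n f 0 / (n.factorial : ℂ)

/-- The majorant sum `r + ∑_{n ≥ 2} |a_n| r^n` of `f(z) = z + ∑_{n ≥ 2} a_n z^n`. -/
def majorant (f : ℂ → ℂ) (r : ℝ) : ℝ :=
  r + ∑' n : ℕ, ‖taylorCoeff f (n + 2)‖ * r ^ (n + 2)

/-- The Euclidean distance `d(f(0), ∂f(𝔻))`. -/
def boundaryDist (f : ℂ → ℂ) : ℝ := Metric.infDist (f 0) (frontier (f '' disk))

end BohrStarlike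

end

/-!
A member `f` of `starlikeClass φ` is `z exp (L z)` with `1 + z L' z = φ (ω z)` for a Schwarz
function `ω`; the extremal function `h = z exp (G z)` is the case `ω z = z`.

For `r ≤ 1 / 3`, the coefficient bound `|a_n| ≤ 2 (1 - |a_0|)` for functions bounded by `1` shows
that the majorant series of `ω z / z` is at most `1`. Majorant series are submultiplicative, so the
one of `φ ∘ ω` is at most that of `φ`. Integration and exponentiation preserve this comparison and
yield `majorant f r ≤ h r`, because the coefficients of `G` are nonnegative.

For the growth estimate `-h (-|z|) ≤ |f z|`, a comparison between `Re L z` and a function of `|z|`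
can only fail first at a point where the angular derivative of `Re L` vanishes, that is, where
`φ (ω z)` is real. For `φ z = (1 + s z) ^ 2` this forces `ω z` to be real, and on the real axis `φ`
is monotone. Hence `d (0, ∂ f 𝔻) ≥ -h (-1)`, with equality for `h`.
-/

noncomputable section

namespace BohrStarlike

open Metric Set Filter Topology

lemma isOpen_disk : IsOpen disk := isOpen_ball

lemma convex_disk : Convex ℝ disk := convex_ball 0 1

lemma mem_disk {z : ℂ} : z ∈ disk ↔ ‖z‖ < 1 := mem_ball_zero_iff

lemma zero_mem_disk : (0 : ℂ) ∈ disk := mem_ball_self one_pos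

lemma disk_mem_nhds {z : ℂ} (hz : z ∈ disk) : disk ∈ 𝓝 z := isOpen_disk.mem_nhds hz

lemma disk_mem_nhds_zero : disk ∈ 𝓝 (0 : ℂ) := disk_mem_nhds zero_mem_disk

lemma ofReal_mem_disk {x : ℝ} : (x : ℂ) ∈ disk ↔ |x| < 1 := by
  rw [mem_disk, Complex.norm_real, Real.norm_eq_abs]

lemma map_zero_add_mul_dslope (f : ℂ → ℂ) (z : ℂ) : f 0 + z * dslope f 0 z = f z := by
  have h := sub_smul_dslope f 0 z
  rw [sub_zero, smul_eq_mul] at h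
  rw [h, add_sub_cancel]

lemma mul_dslope_zero {f : ℂ → ℂ} (h0 : f 0 = 0) (z : ℂ) : z * dslope f 0 z = f z := by
  simpa [h0] using map_zero_add_mul_dslope f z

lemma differentiableOn_dslope {f : ℂ → ℂ} {V : Set ℂ} (hV : V ∈ 𝓝 0)
    (hf : DifferentiableOn ℂ f V) : DifferentiableOn ℂ (dslope f 0) V :=
  (Complex.differentiableOn_dslope hV).mpr hf

section TaylorCoefficients

variable {f g : ℂ → ℂ}

lemma taylorCoeff_congr (h : f =ᶠ[𝓝 0] g) (n : ℕ) : taylorCoeff f n = taylorCoeff g n := by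
  simp only [taylorCoeff, h.iteratedDeriv_eq]

lemma taylorCoeff_zero (f : ℂ → ℂ) : taylorCoeff f 0 = f 0 := by simp [taylorCoeff]

lemma taylorCoeff_one (f : ℂ → ℂ) : taylorCoeff f 1 = deriv f 0 := by simp [taylorCoeff]

lemma taylorCoeff_deriv (f : ℂ → ℂ) (n : ℕ) :
    taylorCoeff (deriv f) n = (n + 1) * taylorCoeff f (n + 1) := by
  have hfac : (n.factorial : ℂ) ≠ 0 := by exact_mod_cast n.factorial_ne_zero
  have hsucc : (n + 1 : ℂ) ≠ 0 := by exact_mod_cast n.succ_ne_zero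
  simp only [taylorCoeff, iteratedDeriv_succ', Nat.factorial_succ, Nat.cast_mul, Nat.cast_add,
    Nat.cast_one]
  field_simp

lemma taylorCoeff_mul (hf : AnalyticAt ℂ f 0) (hg : AnalyticAt ℂ g 0) (n : ℕ) :
    taylorCoeff (fun z => f z * g z) n =
      ∑ i ∈ Finset.range (n + 1), taylorCoeff f i * taylorCoeff g (n - i) := by
  simp only [taylorCoeff]
  rw [iteratedDeriv_fun_mul hf.contDiffAt hg.contDiffAt, Finset.sum_div]
  refine Finset.sum_congr rfl fun i hi => ?_
  have hin : i ≤ n := Finset.mem_range_succ_iff.mp hi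
  have hi : (i.factorial : ℂ) ≠ 0 := by exact_mod_cast i.factorial_ne_zero
  have hni : ((n - i).factorial : ℂ) ≠ 0 := by exact_mod_cast (n - i).factorial_ne_zero
  have hn : (n.factorial : ℂ) ≠ 0 := by exact_mod_cast n.factorial_ne_zero
  rw [Nat.cast_choose ℂ hin]
  field_simp

lemma taylorCoeff_const_mul (c : ℂ) (f : ℂ → ℂ) (n : ℕ) :
    taylorCoeff (fun z => c * f z) n = c * taylorCoeff f n := by
  simp only [taylorCoeff, iteratedDeriv_const_mul_field, mul_div_assoc]

lemma taylorCoeff_const_add (c : ℂ) (f : ℂ → ℂ) {n : ℕ} (hn : n ≠ 0) :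
    taylorCoeff (fun z => c + f z) n = taylorCoeff f n := by
  simp only [taylorCoeff, iteratedDeriv_const_add (Nat.pos_of_ne_zero hn)]

lemma taylorCoeff_const_add_id_mul_succ (c : ℂ) (hg : AnalyticAt ℂ g 0) (n : ℕ) :
    taylorCoeff (fun z => c + z * g z) (n + 1) = taylorCoeff g n := by
  have hid (i : ℕ) : taylorCoeff (fun z => z) (i + 1) = if i = 0 then 1 else 0 := by
    rcases i with _ | i <;> simp [taylorCoeff, iteratedDeriv_succ']
  rw [taylorCoeff_const_add c (fun z => z * g z) n.succ_ne_zero,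
    taylorCoeff_mul (f := fun z => z) analyticAt_id hg, Finset.sum_range_succ', taylorCoeff_zero]
  simp [hid]

lemma analyticAt_dslope (hf : AnalyticAt ℂ f 0) : AnalyticAt ℂ (dslope f 0) 0 :=
  let ⟨_, hp⟩ := hf
  ⟨_, hp.has_fpower_series_dslope_fslope⟩

lemma taylorCoeff_dslope (hf : AnalyticAt ℂ f 0) (n : ℕ) :
    taylorCoeff (dslope f 0) n = taylorCoeff f (n + 1) := by
  rw [← taylorCoeff_const_add_id_mul_succ (f 0) (analyticAt_dslope hf),
    funext (map_zero_add_mul_dslope f)]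

lemma summable_norm_taylorCoeff_dslope (hf : AnalyticAt ℂ f 0) {x : ℝ}
    (hsum : Summable fun n => ‖taylorCoeff f n‖ * x ^ n) :
    Summable fun n => ‖taylorCoeff (dslope f 0) n‖ * x ^ n := by
  rcases eq_or_ne x 0 with rfl | hx
  · exact summable_of_ne_finset_zero (s := {0}) fun n hn => by simp_all
  · refine (summable_mul_right_iff hx).mp (((summable_nat_add_iff 1).mpr hsum).congr fun n => ?_)
    rw [taylorCoeff_dslope hf, pow_succ, mul_assoc]

lemma hasSum_taylorCoeff (hf : DifferentiableOn ℂ f disk) {z : ℂ} (hz : z ∈ disk) :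
    HasSum (fun n => taylorCoeff f n * z ^ n) (f z) := by
  refine (Complex.hasSum_taylorSeries_on_ball hf hz).congr_fun fun n => ?_
  simp only [taylorCoeff, smul_eq_mul, sub_zero]
  ring

lemma summable_norm_taylorCoeff (hf : DifferentiableOn ℂ f disk) {r : ℝ} (hr : |r| < 1) :
    Summable fun n => ‖taylorCoeff f n‖ * r ^ n :=
  .of_norm <| by simpa using (hasSum_taylorCoeff hf (ofReal_mem_disk.mpr hr)).summable.norm

end TaylorCoefficients

/-- The majorant series `∑ |a_n| r^n` of the Taylor series `∑ a_n z^n` of `f` at the origin. For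
`f ∈ 𝒮` it agrees with `majorant`, but it is meaningful without a normalization of `f`. -/
def majorantSum (f : ℂ → ℂ) (r : ℝ) : ℝ := ∑' n : ℕ, ‖taylorCoeff f n‖ * r ^ n

section MajorantSum

variable {f g : ℂ → ℂ} {r : ℝ}

lemma majorantSum_congr (h : f =ᶠ[𝓝 0] g) (r : ℝ) : majorantSum f r = majorantSum g r := by
  simp only [majorantSum, taylorCoeff_congr h]

lemma majorantSum_zero_right (f : ℂ → ℂ) : majorantSum f 0 = ‖f 0‖ := by
  rw [majorantSum, tsum_eq_single 0 fun n hn => by simp [hn], taylorCoeff_zero, pow_zero, mul_one]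

lemma majorantSum_nonneg (f : ℂ → ℂ) (hr : 0 ≤ r) : 0 ≤ majorantSum f r :=
  tsum_nonneg fun n => by positivity

lemma majorantSum_mono (hf : DifferentiableOn ℂ f disk) {ρ : ℝ} (hr : 0 ≤ r) (hrρ : r ≤ ρ)
    (hρ : ρ < 1) : majorantSum f r ≤ majorantSum f ρ := by
  refine Summable.tsum_le_tsum (fun n => by gcongr)
    (summable_norm_taylorCoeff hf ?_) (summable_norm_taylorCoeff hf ?_) <;>
  rw [abs_of_nonneg (by linarith)] <;> linarith

lemma norm_le_majorantSum (hf : DifferentiableOn ℂ f disk) {z : ℂ} (hz : z ∈ disk) :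
    ‖f z‖ ≤ majorantSum f ‖z‖ := by
  have h := hasSum_taylorCoeff hf hz
  rw [← h.tsum_eq]
  refine (norm_tsum_le_tsum_norm h.summable.norm).trans_eq ?_
  simp only [majorantSum, norm_mul, norm_pow]

lemma majorantSum_const_add_id_mul (c : ℂ) (hg : AnalyticAt ℂ g 0)
    (hsum : Summable fun n => ‖taylorCoeff g n‖ * r ^ n) :
    majorantSum (fun z => c + z * g z) r = ‖c‖ + r * majorantSum g r := by
  have hterm (n : ℕ) : ‖taylorCoeff (fun z => c + z * g z) (n + 1)‖ * r ^ (n + 1) =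
      r * (‖taylorCoeff g n‖ * r ^ n) := by
    rw [taylorCoeff_const_add_id_mul_succ c hg, pow_succ]
    ring
  have hsum' : Summable fun n => ‖taylorCoeff (fun z => c + z * g z) n‖ * r ^ n :=
    (summable_nat_add_iff 1).mp ((hsum.mul_left r).congr fun n => (hterm n).symm)
  rw [majorantSum, hsum'.tsum_eq_zero_add, tsum_congr hterm, tsum_mul_left, taylorCoeff_zero,
    zero_mul, add_zero, pow_zero, mul_one, majorantSum]

lemma majorantSum_eq_norm_add_mul_dslope (hf : AnalyticAt ℂ f 0)
    (hsum : Summable fun n => ‖taylorCoeff f n‖ * r ^ n) :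
    majorantSum f r = ‖f 0‖ + r * majorantSum (dslope f 0) r := by
  rw [← majorantSum_const_add_id_mul (f 0) (analyticAt_dslope hf)
    (summable_norm_taylorCoeff_dslope hf hsum), funext (map_zero_add_mul_dslope f)]

lemma majorantSum_eq_mul_dslope (hf : DifferentiableOn ℂ f disk) (h0 : f 0 = 0) (hr : |r| < 1) :
    majorantSum f r = r * majorantSum (dslope f 0) r := by
  rw [majorantSum_eq_norm_add_mul_dslope (hf.analyticAt disk_mem_nhds_zero)
    (summable_norm_taylorCoeff hf hr), h0, norm_zero, zero_add]

-- Truncating one factor keeps the estimate usable in an induction on the truncation order.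
lemma sum_range_norm_taylorCoeff_mul_le (hf : AnalyticAt ℂ f 0) (hg : AnalyticAt ℂ g 0)
    (hr : 0 ≤ r) (hsum : Summable fun n => ‖taylorCoeff f n‖ * r ^ n) (N : ℕ) :
    ∑ n ∈ Finset.range N, ‖taylorCoeff (fun z => f z * g z) n‖ * r ^ n ≤
      majorantSum f r * ∑ n ∈ Finset.range N, ‖taylorCoeff g n‖ * r ^ n := by
  set F : ℕ → ℝ := fun i => ‖taylorCoeff f i‖ * r ^ i
  set G : ℕ → ℝ := fun i => ‖taylorCoeff g i‖ * r ^ i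
  have hF (i : ℕ) : 0 ≤ F i := by positivity
  have hcoeff (n : ℕ) : ‖taylorCoeff (fun z => f z * g z) n‖ * r ^ n ≤
      ∑ i ∈ Finset.range (n + 1), F i * G (n - i) := by
    rw [taylorCoeff_mul hf hg]
    refine (mul_le_mul_of_nonneg_right (norm_sum_le _ _) (by positivity)).trans_eq ?_
    rw [Finset.sum_mul]
    refine Finset.sum_congr rfl fun i hi => ?_
    rw [norm_mul, ← Nat.add_sub_cancel' (Finset.mem_range_succ_iff.mp hi), pow_add,
      Nat.add_sub_cancel_left]
    ring
  calc ∑ n ∈ Finset.range N, ‖taylorCoeff (fun z => f z * g z) n‖ * r ^ n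
      ≤ ∑ n ∈ Finset.range N, ∑ i ∈ Finset.range (n + 1), F i * G (n - i) :=
        Finset.sum_le_sum fun n _ => hcoeff n
    _ = ∑ i ∈ Finset.range N, F i * ∑ k ∈ Finset.range (N - i), G k := by
        simp only [Finset.mul_sum, Finset.sum_range_diag_flip N fun i k => F i * G k]
    _ ≤ ∑ i ∈ Finset.range N, F i * ∑ k ∈ Finset.range N, G k := by
        gcongr with i
        exact Nat.sub_le N i
    _ = (∑ i ∈ Finset.range N, F i) * ∑ k ∈ Finset.range N, G k := (Finset.sum_mul ..).symm
    _ ≤ majorantSum f r * ∑ k ∈ Finset.range N, G k := by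
        gcongr
        exact hsum.sum_le_tsum _ fun i _ => hF i

lemma taylorCoeff_comp_succ {φ ω : ℂ → ℂ} (hφ : AnalyticAt ℂ φ 0) (hω : AnalyticAt ℂ ω 0)
    (h0 : ω 0 = 0) (n : ℕ) : taylorCoeff (fun z => φ (ω z)) (n + 1) =
      taylorCoeff (fun z => dslope ω 0 z * dslope φ 0 (ω z)) n := by
  have hfactor : (fun z => φ (ω z)) = fun z => φ 0 + z * (dslope ω 0 z * dslope φ 0 (ω z)) := by
    ext z
    rw [← mul_assoc, mul_dslope_zero h0, map_zero_add_mul_dslope]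
  rw [hfactor]
  exact taylorCoeff_const_add_id_mul_succ _ ((analyticAt_dslope hω).mul
    ((analyticAt_dslope hφ).comp_of_eq hω h0)) n

lemma sum_range_norm_taylorCoeff_comp_le {φ ω : ℂ → ℂ} {V : Set ℂ} (hV : V ∈ 𝓝 0)
    (hφ : DifferentiableOn ℂ φ V) (hω : DifferentiableOn ℂ ω disk) (hωV : MapsTo ω disk V)
    (h0 : ω 0 = 0) (hr : 0 ≤ r) (hr1 : r < 1)
    (hsum : Summable fun n => ‖taylorCoeff φ n‖ * majorantSum ω r ^ n) (N : ℕ) :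
    ∑ n ∈ Finset.range N, ‖taylorCoeff (fun z => φ (ω z)) n‖ * r ^ n ≤
      majorantSum φ (majorantSum ω r) := by
  have hr' : |r| < 1 := by rwa [abs_of_nonneg hr]
  induction N generalizing φ with
  | zero => simpa using majorantSum_nonneg φ (majorantSum_nonneg ω hr)
  | succ N ih =>
    have hφ₀ := hφ.analyticAt hV
    set B := dslope ω 0
    set ψ : ℂ → ℂ := fun z => dslope φ 0 (ω z)
    have hB : DifferentiableOn ℂ B disk := differentiableOn_dslope disk_mem_nhds_zero hω
    have hφ₁ : DifferentiableOn ℂ (dslope φ 0) V := differentiableOn_dslope hV hφ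
    have hψ : DifferentiableOn ℂ ψ disk := hφ₁.comp hω hωV
    calc ∑ n ∈ Finset.range (N + 1), ‖taylorCoeff (fun z => φ (ω z)) n‖ * r ^ n
        = ‖φ 0‖ + r * ∑ n ∈ Finset.range N, ‖taylorCoeff (fun z => B z * ψ z) n‖ * r ^ n := by
          rw [Finset.sum_range_succ', taylorCoeff_zero, h0, pow_zero, mul_one, add_comm,
            Finset.mul_sum]
          congr 1
          refine Finset.sum_congr rfl fun n _ => ?_
          rw [taylorCoeff_comp_succ hφ₀ (hω.analyticAt disk_mem_nhds_zero) h0, pow_succ]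
          ring
      _ ≤ ‖φ 0‖ + r * (majorantSum B r * majorantSum (dslope φ 0) (majorantSum ω r)) := by
          gcongr
          refine (sum_range_norm_taylorCoeff_mul_le (hB.analyticAt disk_mem_nhds_zero)
            (hψ.analyticAt disk_mem_nhds_zero) hr (summable_norm_taylorCoeff hB hr') N).trans ?_
          gcongr
          · exact majorantSum_nonneg B hr
          · exact ih hφ₁ (summable_norm_taylorCoeff_dslope hφ₀ hsum)
      _ = majorantSum φ (majorantSum ω r) := by
          rw [majorantSum_eq_norm_add_mul_dslope hφ₀ hsum, ← mul_assoc,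
            ← majorantSum_eq_mul_dslope hω h0 hr']

lemma majorantSum_comp_le {φ ω : ℂ → ℂ} {V : Set ℂ} (hV : V ∈ 𝓝 0)
    (hφ : DifferentiableOn ℂ φ V) (hω : DifferentiableOn ℂ ω disk) (hωV : MapsTo ω disk V)
    (h0 : ω 0 = 0) (hr : 0 ≤ r) (hr1 : r < 1)
    (hsum : Summable fun n => ‖taylorCoeff φ n‖ * majorantSum ω r ^ n) :
    majorantSum (fun z => φ (ω z)) r ≤ majorantSum φ (majorantSum ω r) :=
  Real.tsum_le_of_sum_range_le (fun n => by positivity)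
    (sum_range_norm_taylorCoeff_comp_le hV hφ hω hωV h0 hr hr1 hsum)

lemma hasSum_norm_taylorCoeff_exp (x : ℝ) :
    HasSum (fun n => ‖taylorCoeff Complex.exp n‖ * x ^ n) (Real.exp x) := by
  rw [Real.exp_eq_exp_ℝ]
  refine (NormedSpace.expSeries_div_hasSum_exp x).congr_fun fun n => ?_
  simp only [taylorCoeff, iteratedDeriv_eq_iterate, Complex.iter_deriv_exp, Complex.exp_zero,
    norm_div, norm_one, Complex.norm_natCast]
  ring

lemma majorantSum_exp_comp_le (hf : DifferentiableOn ℂ f disk) (h0 : f 0 = 0) (hr : 0 ≤ r)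
    (hr1 : r < 1) : majorantSum (fun z => Complex.exp (f z)) r ≤ Real.exp (majorantSum f r) := by
  have hexp := hasSum_norm_taylorCoeff_exp (majorantSum f r)
  exact (majorantSum_comp_le univ_mem Complex.differentiable_exp.differentiableOn hf
    (mapsTo_univ _ _) h0 hr hr1 hexp.summable).trans_eq hexp.tsum_eq

lemma hasSum_norm_taylorCoeff_mul_deriv_pow (hf : DifferentiableOn ℂ f disk) (hr : |r| < 1) :
    HasSum (fun n : ℕ => ‖taylorCoeff f n‖ * (n * r ^ (n - 1))) (majorantSum (deriv f) r) := by
  have hterm (n : ℕ) : ‖taylorCoeff (deriv f) n‖ * r ^ n =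
      ‖taylorCoeff f (n + 1)‖ * ((n + 1 : ℕ) * r ^ (n + 1 - 1)) := by
    have hnorm : ‖(n + 1 : ℂ)‖ = (n + 1 : ℕ) := by exact_mod_cast Complex.norm_natCast (n + 1)
    rw [taylorCoeff_deriv, norm_mul, hnorm, Nat.add_sub_cancel]
    ring
  rw [← hasSum_nat_add_iff' 1]
  simpa [majorantSum, hterm] using
    (summable_norm_taylorCoeff (hf.deriv isOpen_disk) hr).hasSum

lemma hasDerivAt_majorantSum (hf : DifferentiableOn ℂ f disk) (hr : |r| < 1) :
    HasDerivAt (majorantSum f) (majorantSum (deriv f) r) r := by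
  obtain ⟨ρ, hrρ, hρ1⟩ := exists_between hr
  have hρ0 : 0 ≤ ρ := (abs_nonneg r).trans hrρ.le
  have hρ : |ρ| < 1 := by rwa [abs_of_nonneg hρ0]
  rw [← (hasSum_norm_taylorCoeff_mul_deriv_pow hf hr).tsum_eq]
  refine hasDerivAt_tsum_of_isPreconnected (t := ball 0 ρ) (y₀ := r)
    (g := fun n x => ‖taylorCoeff f n‖ * x ^ n)
    (hasSum_norm_taylorCoeff_mul_deriv_pow hf hρ).summable isOpen_ball
    (convex_ball _ _).isPreconnected (fun n y _ => (hasDerivAt_pow n y).const_mul _)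
    (fun n y hy => ?_) (by simpa using hrρ) (summable_norm_taylorCoeff hf hr) (by simpa using hrρ)
  rw [mem_ball_zero_iff] at hy
  rw [norm_mul, norm_norm, norm_mul, norm_pow, Real.norm_natCast]
  gcongr

end MajorantSum

section Bohr

lemma norm_circleAverage_le {E : Type*} [NormedAddCommGroup E] [NormedSpace ℝ E]
    (f : ℂ → E) (c : ℂ) (R : ℝ) :
    ‖Real.circleAverage f c R‖ ≤ Real.circleAverage (fun z => ‖f z‖) c R := by
  rw [Real.circleAverage_def, Real.circleAverage_def, norm_smul, smul_eq_mul, Real.norm_of_nonneg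
    (by positivity)]
  gcongr
  exact intervalIntegral.norm_integral_le_integral_norm Real.two_pi_pos.le

variable {f p ω : ℂ → ℂ} {n : ℕ} {ρ r : ℝ}

lemma circleAverage_mul_inv_pow (hρ : 0 < ρ) (hp : DifferentiableOn ℂ p (closedBall 0 ρ))
    (n : ℕ) : Real.circleAverage (fun z => p z * (ρ / z) ^ n) 0 ρ = ρ ^ n * taylorCoeff p n := by
  have hcauchy := hp.circleIntegral_one_div_sub_center_pow_smul hρ n
  have hintegrand (z : ℂ) : (z - 0)⁻¹ • (p z * (ρ / z) ^ n) =
      (ρ : ℂ) ^ n * (1 / (z - 0) ^ (n + 1)) • p z := by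
    simp only [sub_zero, smul_eq_mul]
    ring
  rw [Real.circleAverage_eq_circleIntegral hρ.ne']
  simp only [hintegrand]
  rw [circleIntegral.integral_const_mul, hcauchy, taylorCoeff]
  have := Complex.two_pi_I_ne_zero
  simp only [smul_eq_mul]
  field_simp

lemma circleAverage_conj_mul_inv_pow (hρ : 0 < ρ) (hp : DifferentiableOn ℂ p (closedBall 0 ρ))
    (hn : n ≠ 0) :
    Real.circleAverage (fun z => (starRingEnd ℂ) (p z) * (ρ / z) ^ n) 0 ρ = 0 := by
  have hq : DifferentiableOn ℂ (fun z => p z * (z / ρ) ^ n) (closedBall 0 ρ) :=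
    hp.mul ((differentiableOn_id.div_const _).pow n)
  have hconj : EqOn (fun z => (starRingEnd ℂ) (p z) * (ρ / z) ^ n)
      (Complex.conjCLE.toContinuousLinearMap ∘ fun z => p z * (z / ρ) ^ n) (sphere 0 |ρ|) := by
    intro z hz
    rw [abs_of_pos hρ, mem_sphere_zero_iff_norm] at hz
    have hz0 : z ≠ 0 := norm_pos_iff.mp (hz ▸ hρ)
    have hρ0 : (ρ : ℂ) ≠ 0 := by exact_mod_cast hρ.ne'
    have : (ρ : ℂ) / z = (starRingEnd ℂ) z / ρ := by
      rw [div_eq_div_iff hz0 hρ0, mul_comm ((starRingEnd ℂ) z), Complex.mul_conj,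
        Complex.normSq_eq_norm_sq, hz]
      push_cast
      ring
    simp [this]
  rw [Real.circleAverage_congr_sphere hconj, ContinuousLinearMap.circleAverage_comp_comm _
    ((hq.continuousOn.mono sphere_subset_closedBall).circleIntegrable hρ.le),
    DiffContOnCl.circleAverage]
  · simp [hn]
  · rw [abs_of_pos hρ]
    exact (hq.mono closure_ball_subset_closedBall).diffContOnCl

lemma circleAverage_re (hρ : 0 < ρ) (hp : DifferentiableOn ℂ p (closedBall 0 ρ)) :
    Real.circleAverage (fun z => (p z).re) 0 ρ = (p 0).re := by
  change Real.circleAverage (Complex.reCLM ∘ p) 0 ρ = (p 0).re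
  rw [ContinuousLinearMap.circleAverage_comp_comm _
    ((hp.continuousOn.mono sphere_subset_closedBall).circleIntegrable hρ.le),
    DiffContOnCl.circleAverage, Complex.reCLM_apply]
  rw [abs_of_pos hρ]
  exact (hp.mono closure_ball_subset_closedBall).diffContOnCl

lemma circleAverage_two_re_mul_inv_pow (hρ : 0 < ρ)
    (hp : DifferentiableOn ℂ p (closedBall 0 ρ)) (hn : n ≠ 0) :
    Real.circleAverage (fun z => (2 * (p z).re : ℂ) * (ρ / z) ^ n) 0 ρ =
      ρ ^ n * taylorCoeff p n := by
  have hpc : ContinuousOn p (sphere 0 ρ) := hp.continuousOn.mono sphere_subset_closedBall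
  have hinv : ContinuousOn (fun z : ℂ => (ρ / z) ^ n) (sphere 0 ρ) :=
    (continuousOn_const.div continuousOn_id fun z hz =>
      ne_of_mem_sphere hz hρ.ne').pow n
  have hsplit (z : ℂ) : (2 * (p z).re : ℂ) * (ρ / z) ^ n =
      p z * (ρ / z) ^ n + (starRingEnd ℂ) (p z) * (ρ / z) ^ n := by
    rw [← add_mul, Complex.add_conj]
    push_cast
    rfl
  have hint : CircleIntegrable (fun z => p z * (ρ / z) ^ n) 0 ρ :=
    (hpc.mul hinv).circleIntegrable hρ.le
  have hint' : CircleIntegrable (fun z => (starRingEnd ℂ) (p z) * (ρ / z) ^ n) 0 ρ :=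
    ((Complex.continuous_conj.comp_continuousOn hpc).mul hinv).circleIntegrable hρ.le
  simp only [hsplit]
  rw [Real.circleAverage_fun_add hint hint', circleAverage_mul_inv_pow hρ hp,
    circleAverage_conj_mul_inv_pow hρ hp hn, add_zero]

lemma pow_mul_norm_taylorCoeff_le (hρ : 0 < ρ) (hp : DifferentiableOn ℂ p (closedBall 0 ρ))
    (hre : ∀ z ∈ closedBall 0 ρ, 0 ≤ (p z).re) (hn : n ≠ 0) :
    ρ ^ n * ‖taylorCoeff p n‖ ≤ 2 * (p 0).re := by
  have hnorm : EqOn (fun z => ‖(2 * (p z).re : ℂ) * (ρ / z) ^ n‖)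
      (fun z => (2 : ℝ) • (p z).re) (sphere 0 |ρ|) := by
    intro z hz
    rw [abs_of_pos hρ] at hz
    have hz' : ‖z‖ = ρ := mem_sphere_zero_iff_norm.mp hz
    have := hre z (sphere_subset_closedBall hz)
    simp [hz', abs_of_pos hρ, hρ.ne', abs_of_nonneg this]
  calc ρ ^ n * ‖taylorCoeff p n‖
      = ‖Real.circleAverage (fun z => (2 * (p z).re : ℂ) * (ρ / z) ^ n) 0 ρ‖ := by
        rw [circleAverage_two_re_mul_inv_pow hρ hp hn]
        simp [abs_of_pos hρ]
    _ ≤ Real.circleAverage (fun z => ‖(2 * (p z).re : ℂ) * (ρ / z) ^ n‖) 0 ρ :=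
        norm_circleAverage_le _ _ _
    _ = 2 * (p 0).re := by
        rw [Real.circleAverage_congr_sphere hnorm, Real.circleAverage_fun_smul,
          circleAverage_re hρ hp, smul_eq_mul]

lemma norm_taylorCoeff_le_of_re_nonneg (hp : DifferentiableOn ℂ p disk)
    (hre : ∀ z ∈ disk, 0 ≤ (p z).re) (hn : n ≠ 0) : ‖taylorCoeff p n‖ ≤ 2 * (p 0).re := by
  have hlim : Tendsto (fun ρ : ℝ => ρ ^ n * ‖taylorCoeff p n‖) (𝓝[<] 1)
      (𝓝 (1 ^ n * ‖taylorCoeff p n‖)) :=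
    ((by fun_prop : Continuous fun ρ : ℝ => ρ ^ n * ‖taylorCoeff p n‖).tendsto 1).mono_left
      nhdsWithin_le_nhds
  rw [one_pow, one_mul] at hlim
  refine le_of_tendsto hlim ?_
  filter_upwards [Ioo_mem_nhdsLT one_pos] with ρ ⟨hρ0, hρ1⟩
  have hsub : closedBall 0 ρ ⊆ disk := closedBall_subset_ball hρ1
  exact pow_mul_norm_taylorCoeff_le hρ0 (hp.mono hsub) (fun z hz => hre z (hsub hz)) hn

lemma norm_taylorCoeff_le_of_norm_le_one (hf : DifferentiableOn ℂ f disk)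
    (hb : ∀ z ∈ disk, ‖f z‖ ≤ 1) (hn : n ≠ 0) : ‖taylorCoeff f n‖ ≤ 2 * (1 - ‖f 0‖) := by
  obtain ⟨η, hη, hη0⟩ : ∃ η : ℂ, ‖η‖ = 1 ∧ η * f 0 = -‖f 0‖ := by
    rcases eq_or_ne (f 0) 0 with h | h
    · exact ⟨1, by simp [h]⟩
    · exact ⟨-‖f 0‖ / f 0, by simp [h], by field_simp⟩
  have hre (z : ℂ) (hz : z ∈ disk) : 0 ≤ (1 + η * f z).re := by
    have : |(η * f z).re| ≤ 1 :=
      (Complex.abs_re_le_norm _).trans (by simpa only [norm_mul, hη, one_mul] using hb z hz)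
    rw [Complex.add_re, Complex.one_re]
    linarith [(abs_le.mp this).1]
  have h := norm_taylorCoeff_le_of_re_nonneg ((hf.const_mul η).const_add 1) hre hn
  rw [taylorCoeff_const_add 1 (fun z => η * f z) hn, taylorCoeff_const_mul, norm_mul, hη, one_mul,
    hη0] at h
  simpa [sub_eq_add_neg] using h

lemma majorantSum_le_one (hf : DifferentiableOn ℂ f disk) (hb : ∀ z ∈ disk, ‖f z‖ ≤ 1)
    (hr : 0 ≤ r) (hr3 : r ≤ 1 / 3) : majorantSum f r ≤ 1 := by
  have hsum := summable_norm_taylorCoeff hf (r := r) (by rw [abs_of_nonneg hr]; linarith)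
  set C := 2 * (1 - ‖f 0‖)
  have hcoeff (n : ℕ) : ‖taylorCoeff f (n + 1)‖ * r ^ (n + 1) ≤ C / 3 * (1 / 3) ^ n := by
    have hC := norm_taylorCoeff_le_of_norm_le_one hf hb n.succ_ne_zero
    calc ‖taylorCoeff f (n + 1)‖ * r ^ (n + 1)
        ≤ C * (1 / 3) ^ (n + 1) := by
          have : 0 ≤ C := (norm_nonneg _).trans hC
          gcongr
      _ = C / 3 * (1 / 3) ^ n := by ring
  have hgeom : HasSum (fun n : ℕ => C / 3 * (1 / 3 : ℝ) ^ n) (C / 3 * (1 - 1 / 3)⁻¹) :=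
    (hasSum_geometric_of_lt_one (by norm_num) (by norm_num)).mul_left _
  calc majorantSum f r
      = ‖f 0‖ + ∑' n : ℕ, ‖taylorCoeff f (n + 1)‖ * r ^ (n + 1) := by
        rw [majorantSum, hsum.tsum_eq_zero_add, taylorCoeff_zero, pow_zero, mul_one]
    _ ≤ ‖f 0‖ + C / 3 * (1 - 1 / 3)⁻¹ := by
        grw [((summable_nat_add_iff 1).mpr hsum).tsum_le_tsum hcoeff hgeom.summable,
          hgeom.tsum_eq]
    _ = 1 := by ring

lemma majorantSum_schwarz_le (hω : DifferentiableOn ℂ ω disk) (hωm : MapsTo ω disk disk)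
    (h0 : ω 0 = 0) (hr : 0 ≤ r) (hr3 : r ≤ 1 / 3) : majorantSum ω r ≤ r := by
  have hball : MapsTo ω (ball 0 1) (closedBall (ω 0) 1) := by
    rw [h0]
    exact hωm.mono_right ball_subset_closedBall
  have hquot (z : ℂ) (hz : z ∈ disk) : ‖dslope ω 0 z‖ ≤ 1 := by
    simpa using Complex.norm_dslope_le_div_of_mapsTo_ball hω hball hz
  rw [majorantSum_eq_mul_dslope hω h0 (by rw [abs_of_nonneg hr]; linarith)]
  exact mul_le_of_le_one_right hr
    (majorantSum_le_one (differentiableOn_dslope disk_mem_nhds_zero hω) hquot hr hr3)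

lemma majorantSum_comp_schwarz_le {φ : ℂ → ℂ} (hφ : DifferentiableOn ℂ φ disk)
    (hω : DifferentiableOn ℂ ω disk) (hωm : MapsTo ω disk disk) (h0 : ω 0 = 0) (hr : 0 ≤ r)
    (hr3 : r ≤ 1 / 3) : majorantSum (fun z => φ (ω z)) r ≤ majorantSum φ r := by
  have hr1 : r < 1 := by linarith
  have hωr := majorantSum_schwarz_le hω hωm h0 hr hr3
  have hω0 := majorantSum_nonneg ω hr
  exact (majorantSum_comp_le disk_mem_nhds_zero hφ hω hωm h0 hr hr1
    (summable_norm_taylorCoeff hφ (by rw [abs_of_nonneg hω0]; linarith))).trans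
    (majorantSum_mono hφ hω0 hωr hr1)

end Bohr

/-- The function `z ↦ z exp (L z)`; every normalized univalent function on the disk has this form,
with `L` a holomorphic branch of `log (f z / z)`. -/
def mulExp (L : ℂ → ℂ) (z : ℂ) : ℂ := z * Complex.exp (L z)

section MulExp

variable {f F L : ℂ → ℂ} {z L' : ℂ}

lemma norm_mulExp (L : ℂ → ℂ) (z : ℂ) : ‖mulExp L z‖ = ‖z‖ * Real.exp (L z).re := by
  rw [mulExp, norm_mul, Complex.norm_exp]

lemma mulExp_eq_zero : mulExp L z = 0 ↔ z = 0 := by simp [mulExp, Complex.exp_ne_zero]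

lemma hasDerivAt_mulExp (hL : HasDerivAt L L' z) :
    HasDerivAt (mulExp L) ((1 + z * L') * Complex.exp (L z)) z := by
  convert! (hasDerivAt_id' z).mul hL.cexp using 1
  ring

lemma logDerivQuot_congr {g : ℂ → ℂ} (h : EqOn f g disk) (hz : z ∈ disk) :
    logDerivQuot f z = logDerivQuot g z := by
  rcases eq_or_ne z 0 with rfl | hz0
  · simp [logDerivQuot]
  · simp only [logDerivQuot, Function.update_of_ne hz0, h hz,
      (h.eventuallyEq_of_mem (disk_mem_nhds hz)).deriv_eq]

lemma logDerivQuot_mulExp (hL : DifferentiableAt ℂ L z) :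
    logDerivQuot (mulExp L) z = 1 + z * deriv L z := by
  rcases eq_or_ne z 0 with rfl | hz
  · simp [logDerivQuot]
  · rw [logDerivQuot, Function.update_of_ne hz, (hasDerivAt_mulExp hL.hasDerivAt).deriv, mulExp]
    field_simp [Complex.exp_ne_zero]

lemma exists_log (hF : DifferentiableOn ℂ F disk) (hF0 : ∀ z ∈ disk, F z ≠ 0) (h1 : F 0 = 1) :
    ∃ L : ℂ → ℂ, DifferentiableOn ℂ L disk ∧ L 0 = 0 ∧ ∀ z ∈ disk, F z = Complex.exp (L z) := by
  obtain ⟨L, hL0, hL⟩ :=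
    ((hF.deriv isOpen_disk).fun_div hF hF0).isExactOn_ball.with_val_at 0 0
  refine ⟨L, fun z hz => (hL z hz).differentiableAt.differentiableWithinAt, hL0, fun z hz => ?_⟩
  have hconst (w : ℂ) (hw : w ∈ disk) :
      HasDerivAt (fun w => F w * Complex.exp (-L w)) 0 w := by
    convert! (hF.differentiableAt (disk_mem_nhds hw)).hasDerivAt.mul (hL w hw).neg.cexp using 1
    have := hF0 w hw
    field_simp
    ring
  have heq := isOpen_disk.is_const_of_deriv_eq_zero convex_disk.isPreconnected
    (fun w hw => (hconst w hw).differentiableAt.differentiableWithinAt)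
    (fun w hw => (hconst w hw).deriv) hz zero_mem_disk
  simpa only [h1, hL0, neg_zero, Complex.exp_zero, mul_one, Complex.exp_neg, ← div_eq_mul_inv,
    div_eq_one_iff_eq (Complex.exp_ne_zero _)] using heq

lemma exists_eqOn_mulExp (hf : f ∈ classS) :
    ∃ L : ℂ → ℂ, DifferentiableOn ℂ L disk ∧ L 0 = 0 ∧ EqOn f (mulExp L) disk := by
  obtain ⟨hfd, hinj, hf0, hf1⟩ := hf
  have hquot (z : ℂ) (hz : z ∈ disk) : dslope f 0 z ≠ 0 := by
    rcases eq_or_ne z 0 with rfl | hz0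
    · simp [hf1]
    · exact fun h => hz0 (hinj hz zero_mem_disk (by rw [← mul_dslope_zero hf0, h, mul_zero, hf0]))
  obtain ⟨L, hL, hL0, hexp⟩ := exists_log (differentiableOn_dslope disk_mem_nhds_zero hfd) hquot
    (by rw [dslope_same, hf1])
  refine ⟨L, hL, hL0, fun z hz => ?_⟩
  rw [mulExp, ← hexp z hz, mul_dslope_zero hf0]

end MulExp

section Univalence

variable {f L : ℂ → ℂ} {U : Set ℂ}

lemma injOn_of_re_deriv_pos (hU : Convex ℝ U) {f' : ℂ → ℂ}
    (hf : ∀ w ∈ U, HasDerivAt f (f' w) w) (hpos : ∀ w ∈ U, 0 < (f' w).re) : InjOn f U := by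
  intro a ha b hb hab
  by_contra hne
  have hmem (t : ℝ) (ht : t ∈ Icc (0 : ℝ) 1) : a + t * (b - a) ∈ U := by
    simpa using hU.add_smul_sub_mem ha hb ht
  let ψ : ℝ → ℝ := fun t => (f (a + t * (b - a)) * (starRingEnd ℂ) (b - a)).re
  have hψ (t : ℝ) (ht : t ∈ Icc (0 : ℝ) 1) :
      HasDerivAt ψ (Complex.normSq (b - a) * (f' (a + t * (b - a))).re) t := by
    have hpath : HasDerivAt (fun t : ℝ => a + (t : ℂ) * (b - a)) (b - a) t := by
      simpa using ((Complex.ofRealCLM.hasDerivAt (x := t)).mul_const (b - a)).const_add a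
    convert! Complex.reCLM.hasFDerivAt.comp_hasDerivAt t
      (((hf _ (hmem t ht)).comp t hpath).mul_const ((starRingEnd ℂ) (b - a))) using 1
    rw [mul_assoc, Complex.mul_conj, mul_comm, Complex.reCLM_apply, Complex.re_mul_ofReal]
  obtain ⟨t, ht, h⟩ := exists_hasDerivAt_eq_zero (zero_lt_one' ℝ)
    (fun t ht => (hψ t ht).continuousAt.continuousWithinAt)
    (by simp [ψ, hab]) (fun t ht => hψ t (Ioo_subset_Icc_self ht))
  exact (mul_pos (Complex.normSq_pos.mpr (sub_ne_zero.mpr (Ne.symm hne)))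
    (hpos _ (hmem t (Ioo_subset_Icc_self ht)))).ne' h

lemma injOn_add_comp_exp (hL : DifferentiableOn ℂ L disk)
    (hpos : ∀ z ∈ disk, 0 < (1 + z * deriv L z).re) :
    InjOn (fun w => w + L (Complex.exp w)) {w | w.re < 0} := by
  have hexp {w : ℂ} (hw : w.re < 0) : Complex.exp w ∈ disk := by
    rwa [mem_disk, Complex.norm_exp, Real.exp_lt_one_iff]
  refine injOn_of_re_deriv_pos (convex_halfSpace_re_lt 0) (fun w hw => ?_)
    (fun w hw => hpos (Complex.exp w) (hexp hw))
  rw [mul_comm]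
  exact (hasDerivAt_id' w).add ((hL.differentiableAt (disk_mem_nhds (hexp hw))).hasDerivAt.comp w
    (Complex.hasDerivAt_exp w))

-- In the coordinate `w = log z` the map `mulExp L` becomes `w ↦ w + L (exp w)`.
lemma injOn_mulExp (hL : DifferentiableOn ℂ L disk)
    (hpos : ∀ z ∈ disk, 0 < (1 + z * deriv L z).re) : InjOn (mulExp L) disk := by
  have hinj := injOn_add_comp_exp hL hpos
  have hlog {z : ℂ} (hz : z ∈ disk) (hz0 : z ≠ 0) : (Complex.log z).re < 0 := by
    rw [Complex.log_re]
    exact Real.log_neg (norm_pos_iff.mpr hz0) (mem_disk.mp hz)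
  have hlift {z : ℂ} (hz0 : z ≠ 0) :
      mulExp L z = Complex.exp (Complex.log z + L (Complex.exp (Complex.log z))) := by
    rw [Complex.exp_add, Complex.exp_log hz0, mulExp]
  intro z₁ h₁ z₂ h₂ h
  rcases eq_or_ne z₁ 0 with rfl | hz₁
  · exact (mulExp_eq_zero.mp (h.symm.trans (mulExp_eq_zero.mpr rfl))).symm
  have hz₂ : z₂ ≠ 0 := fun hz => hz₁ (mulExp_eq_zero.mp (h.trans (mulExp_eq_zero.mpr hz)))
  rw [hlift hz₁, hlift hz₂] at h
  obtain ⟨n, hn⟩ := Complex.exp_eq_exp_iff_exists_int.mp h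
  have hshift : Complex.exp (Complex.log z₂ + n * (2 * Real.pi * Complex.I)) =
      Complex.exp (Complex.log z₂) := Complex.exp_eq_exp_iff_exists_int.mpr ⟨n, rfl⟩
  have hw : Complex.log z₁ = Complex.log z₂ + n * (2 * Real.pi * Complex.I) := by
    refine hinj (hlog h₁ hz₁) ?_ ?_
    · simpa using hlog h₂ hz₂
    · simp only [hshift, hn]
      ring
  rw [← Complex.exp_log hz₁, hw, hshift, Complex.exp_log hz₂]

end Univalence

/-- `L` is the function with `L 0 = 0` for which `f = mulExp L` satisfies `z f' z / f z = φ z` on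
the disk. For `φ` of positive real part this `f` is the Ma-Minda extremal function of
`starlikeClass φ`. -/
structure IsMaMindaLog (φ L : ℂ → ℂ) : Prop where
  differentiableOn : DifferentiableOn ℂ L disk
  map_zero : L 0 = 0
  one_add_mul_deriv : ∀ z ∈ disk, 1 + z * deriv L z = φ z

namespace IsMaMindaLog

variable {φ f G L : ℂ → ℂ} {z : ℂ}

lemma differentiableAt (hG : IsMaMindaLog φ G) (hz : z ∈ disk) : DifferentiableAt ℂ G z :=
  hG.differentiableOn.differentiableAt (disk_mem_nhds hz)

lemma differentiableOn_left (hG : IsMaMindaLog φ G) : DifferentiableOn ℂ φ disk :=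
  (((differentiableOn_id.fun_mul (hG.differentiableOn.deriv isOpen_disk)).const_add 1).congr
    fun z hz => (hG.one_add_mul_deriv z hz).symm)

lemma logDerivQuot_eq (hG : IsMaMindaLog φ G) (hz : z ∈ disk) :
    logDerivQuot (mulExp G) z = φ z := by
  rw [logDerivQuot_mulExp (hG.differentiableAt hz), hG.one_add_mul_deriv z hz]

lemma mulExp_mem_starlikeClass (hG : IsMaMindaLog φ G) (hpos : ∀ z ∈ disk, 0 < (φ z).re) :
    mulExp G ∈ starlikeClass φ := by
  have hd {z : ℂ} (hz : z ∈ disk) := hasDerivAt_mulExp (hG.differentiableAt hz).hasDerivAt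
  have hinj : InjOn (mulExp G) disk := injOn_mulExp hG.differentiableOn fun z hz => by
    rw [hG.one_add_mul_deriv z hz]
    exact hpos z hz
  refine ⟨⟨fun z hz => (hd hz).differentiableAt.differentiableWithinAt, hinj,
    mulExp_eq_zero.mpr rfl, ?_⟩, id, differentiableOn_id, mapsTo_id _, rfl,
    fun z hz => hG.logDerivQuot_eq hz⟩
  rw [(hd zero_mem_disk).deriv, hG.map_zero]
  simp

lemma exists_of_mem_starlikeClass (hf : f ∈ starlikeClass φ) :
    ∃ ω L : ℂ → ℂ, DifferentiableOn ℂ ω disk ∧ MapsTo ω disk disk ∧ ω 0 = 0 ∧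
      IsMaMindaLog (fun z => φ (ω z)) L ∧ EqOn f (mulExp L) disk := by
  obtain ⟨hS, ω, hω, hωm, h0, hsub⟩ := hf
  obtain ⟨L, hL, hL0, hfL⟩ := exists_eqOn_mulExp hS
  refine ⟨ω, L, hω, hωm, h0, ⟨hL, hL0, fun z hz => ?_⟩, hfL⟩
  rw [← hsub z hz, logDerivQuot_congr hfL hz,
    logDerivQuot_mulExp (hL.differentiableAt (disk_mem_nhds hz))]

end IsMaMindaLog

section Majorant

lemma majorantSum_le_of_deriv {f g : ℂ → ℂ} {r : ℝ} (hf : DifferentiableOn ℂ f disk)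
    (hg : DifferentiableOn ℂ g disk) (hr : 0 ≤ r) (hr1 : r < 1) (h0 : ‖f 0‖ ≤ ‖g 0‖)
    (h : ∀ t ∈ Ioo 0 r, majorantSum (deriv f) t ≤ majorantSum (deriv g) t) :
    majorantSum f r ≤ majorantSum g r := by
  have hd (t : ℝ) (ht : t ∈ Icc 0 r) : HasDerivAt (fun t => majorantSum g t - majorantSum f t)
      (majorantSum (deriv g) t - majorantSum (deriv f) t) t := by
    have ht1 : |t| < 1 := by rw [abs_of_nonneg ht.1]; exact lt_of_le_of_lt ht.2 hr1
    exact (hasDerivAt_majorantSum hg ht1).sub (hasDerivAt_majorantSum hf ht1)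
  have hmono : MonotoneOn (fun t => majorantSum g t - majorantSum f t) (Icc 0 r) := by
    refine monotoneOn_of_deriv_nonneg (convex_Icc 0 r)
      (fun t ht => (hd t ht).continuousAt.continuousWithinAt)
      (fun t ht => (hd t (interior_subset ht)).differentiableAt.differentiableWithinAt)
      fun t ht => ?_
    rw [(hd t (interior_subset ht)).deriv, sub_nonneg]
    exact h t (by rwa [interior_Icc] at ht)
  have := hmono (left_mem_Icc.mpr hr) (right_mem_Icc.mpr hr) hr
  simp only [majorantSum_zero_right] at this
  linarith

variable {φ ω f G L : ℂ → ℂ} {r : ℝ}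

lemma IsMaMindaLog.one_add_mul_majorantSum_deriv (hG : IsMaMindaLog φ G) (hr : |r| < 1) :
    1 + r * majorantSum (deriv G) r = majorantSum φ r := by
  have hd := hG.differentiableOn.deriv isOpen_disk
  rw [← majorantSum_congr (eventually_of_mem disk_mem_nhds_zero hG.one_add_mul_deriv) r,
    majorantSum_const_add_id_mul 1 (hd.analyticAt disk_mem_nhds_zero)
      (summable_norm_taylorCoeff hd hr), norm_one]

lemma IsMaMindaLog.majorantSum_le (hG : IsMaMindaLog φ G)
    (hω : DifferentiableOn ℂ ω disk) (hωm : MapsTo ω disk disk) (h0 : ω 0 = 0)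
    (hL : IsMaMindaLog (fun z => φ (ω z)) L) (hr : 0 ≤ r) (hr3 : r ≤ 1 / 3) :
    majorantSum L r ≤ majorantSum G r := by
  refine majorantSum_le_of_deriv hL.differentiableOn hG.differentiableOn hr (by linarith)
    (by rw [hL.map_zero, hG.map_zero]) fun t ht => ?_
  have ht1 : |t| < 1 := by rw [abs_of_pos ht.1]; linarith [ht.2]
  have hφ := majorantSum_comp_schwarz_le hG.differentiableOn_left hω hωm h0 ht.1.le
    (ht.2.le.trans hr3)
  rw [← hL.one_add_mul_majorantSum_deriv ht1, ← hG.one_add_mul_majorantSum_deriv ht1] at hφ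
  exact le_of_mul_le_mul_left (by linarith) ht.1

lemma summable_majorant (hf : f ∈ classS) (hr : |r| < 1) :
    Summable fun n : ℕ => ‖taylorCoeff f (n + 2)‖ * r ^ (n + 2) :=
  (summable_nat_add_iff 2).mpr (summable_norm_taylorCoeff hf.1 hr)

lemma majorant_eq_majorantSum (hf : f ∈ classS) (hr : |r| < 1) :
    majorant f r = majorantSum f r := by
  rw [majorantSum, ← (summable_norm_taylorCoeff hf.1 hr).sum_add_tsum_nat_add 2]
  simp [majorant, Finset.sum_range_succ, taylorCoeff_zero, taylorCoeff_one, hf.2.2.1, hf.2.2.2]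

lemma majorantSum_mulExp_le (hL : DifferentiableOn ℂ L disk) (hL0 : L 0 = 0) (hr : 0 ≤ r)
    (hr1 : r < 1) : majorantSum (mulExp L) r ≤ r * Real.exp (majorantSum L r) := by
  have hexp : DifferentiableOn ℂ (fun z => Complex.exp (L z)) disk := hL.cexp
  have hr' : |r| < 1 := by rwa [abs_of_nonneg hr]
  have heq : mulExp L = fun z => 0 + z * Complex.exp (L z) := by
    funext z
    rw [zero_add, mulExp]
  rw [heq, majorantSum_const_add_id_mul 0 (hexp.analyticAt disk_mem_nhds_zero)
    (summable_norm_taylorCoeff hexp hr'), norm_zero, zero_add]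
  exact mul_le_mul_of_nonneg_left (majorantSum_exp_comp_le hL hL0 hr hr1) hr

lemma IsMaMindaLog.majorant_le (hG : IsMaMindaLog φ G) (hf : f ∈ starlikeClass φ) (hr : 0 ≤ r)
    (hr3 : r ≤ 1 / 3) : majorant f r ≤ r * Real.exp (majorantSum G r) := by
  obtain ⟨ω, L, hω, hωm, h0, hL, hfL⟩ := exists_of_mem_starlikeClass hf
  have hr1 : r < 1 := by linarith
  calc majorant f r
      = majorantSum (mulExp L) r := by
        rw [majorant_eq_majorantSum hf.1 (by rwa [abs_of_nonneg hr]),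
          majorantSum_congr (hfL.eventuallyEq_of_mem disk_mem_nhds_zero)]
    _ ≤ r * Real.exp (majorantSum L r) :=
        majorantSum_mulExp_le hL.differentiableOn hL.map_zero hr hr1
    _ ≤ r * Real.exp (majorantSum G r) := by
        gcongr
        exact hG.majorantSum_le hω hωm h0 hL hr hr3

end Majorant

section Growth

variable {L : ℂ → ℂ} {w : ℂ}

lemma hasDerivAt_re_comp_mul_exp (hL : DifferentiableAt ℂ L w) (c : ℂ) :
    HasDerivAt (fun t : ℝ => (L (w * Complex.exp (t * c))).re) (c * (w * deriv L w)).re 0 := by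
  have hpath : HasDerivAt (fun t : ℝ => w * Complex.exp (t * c)) (w * c) 0 := by
    simpa using
      (((Complex.ofRealCLM.hasDerivAt (x := (0 : ℝ))).mul_const c).cexp).const_mul w
  have hcomp : HasDerivAt L (deriv L w) (w * Complex.exp ((0 : ℝ) * c)) := by
    simpa using hL.hasDerivAt
  convert! Complex.reCLM.hasFDerivAt.comp_hasDerivAt (0 : ℝ) (hcomp.comp (0 : ℝ) hpath) using 1
  rw [Complex.reCLM_apply]
  ring_nf

lemma im_mul_deriv_eq_zero_of_isMinOn (hL : DifferentiableAt ℂ L w)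
    (hmin : ∀ v, ‖v‖ = ‖w‖ → (L w).re ≤ (L v).re) : (w * deriv L w).im = 0 := by
  have hloc : IsLocalMin (fun t : ℝ => (L (w * Complex.exp (t * Complex.I))).re) 0 :=
    Eventually.of_forall fun t => by
      simpa using hmin (w * Complex.exp (t * Complex.I)) (by simp [Complex.norm_exp_ofReal_mul_I])
  have h := hloc.hasDerivAt_eq_zero (hasDerivAt_re_comp_mul_exp hL Complex.I)
  rwa [Complex.I_mul_re, neg_eq_zero] at h

lemma re_mul_deriv_le_of_isMinOn (hL : DifferentiableAt ℂ L w) {K : ℝ → ℝ} {k : ℝ}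
    (hK : HasDerivAt K k ‖w‖)
    (hmin : ∀ v, ‖v‖ ≤ ‖w‖ → (L w).re - K ‖w‖ ≤ (L v).re - K ‖v‖) :
    (w * deriv L w).re ≤ ‖w‖ * k := by
  have hnorm (t : ℝ) : ‖w * Complex.exp (t * 1)‖ = ‖w‖ * Real.exp t := by
    rw [mul_one, norm_mul, Complex.norm_exp, Complex.ofReal_re]
  let ψ : ℝ → ℝ := fun t => (L (w * Complex.exp (t * 1))).re - K (‖w‖ * Real.exp t)
  have hψ : HasDerivAt ψ ((w * deriv L w).re - ‖w‖ * k) 0 := by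
    have hKexp : HasDerivAt K k (‖w‖ * Real.exp 0) := by simpa using hK
    convert! (hasDerivAt_re_comp_mul_exp hL 1).sub
      (hKexp.comp (0 : ℝ) ((Real.hasDerivAt_exp 0).const_mul ‖w‖)) using 1
    rw [one_mul, Real.exp_zero, mul_one, mul_comm k]
  have hslope := (hasDerivAt_iff_tendsto_slope.mp hψ).mono_left
    (nhdsWithin_mono 0 fun t (ht : t ∈ Iio (0 : ℝ)) => ht.ne)
  refine sub_nonpos.mp (le_of_tendsto hslope ?_)
  filter_upwards [self_mem_nhdsWithin] with t ht
  have ht0 : t < 0 := ht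
  have hψt : ψ 0 ≤ ψ t := by
    have := hmin (w * Complex.exp (t * 1)) (by
      rw [hnorm]
      exact mul_le_of_le_one_right (norm_nonneg w) (Real.exp_le_one_iff.mpr ht0.le))
    simpa [ψ, hnorm] using this
  rw [slope_def_field]
  exact div_nonpos_of_nonneg_of_nonpos (by linarith) (by linarith)

/-- It suffices to compare the radial derivatives where the angular derivative of `Re L` vanishes:
a minimum of `Re L z - H ‖z‖ + ε ‖z‖` away from `0` is such a point. -/
lemma le_re_of_le_re_mul_deriv {H H' : ℝ → ℝ} (hL : DifferentiableOn ℂ L disk)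
    (hH : ∀ x ∈ Ico (0 : ℝ) 1, HasDerivAt H (H' x) x) (h0 : H 0 ≤ (L 0).re)
    (h : ∀ w ∈ disk, (w * deriv L w).im = 0 → ‖w‖ * H' ‖w‖ ≤ (w * deriv L w).re)
    {z : ℂ} (hz : z ∈ disk) : H ‖z‖ ≤ (L z).re := by
  have hnorm {v : ℂ} (hv : ‖v‖ ≤ ‖z‖) : ‖v‖ ∈ Ico (0 : ℝ) 1 :=
    ⟨norm_nonneg v, hv.trans_lt (mem_disk.mp hz)⟩
  refine le_of_forall_pos_le_add fun ε hε => ?_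
  let K : ℝ → ℝ := fun x => H x - ε * x
  have hK {v : ℂ} (hv : ‖v‖ ≤ ‖z‖) : HasDerivAt K (H' ‖v‖ - ε) ‖v‖ := by
    simpa only [mul_one] using (hH _ (hnorm hv)).fun_sub ((hasDerivAt_id' ‖v‖).const_mul ε)
  have hcont : ContinuousOn (fun v => (L v).re - K ‖v‖) (closedBall 0 ‖z‖) := fun v hv =>
    have hv' : ‖v‖ ≤ ‖z‖ := by simpa using hv
    (ContinuousAt.sub (Complex.continuous_re.continuousAt.comp
        (hL.differentiableAt (disk_mem_nhds (mem_disk.mpr (hnorm hv').2))).continuousAt)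
      ((hK hv').continuousAt.comp continuous_norm.continuousAt)).continuousWithinAt
  obtain ⟨w, hw, hmin⟩ := (isCompact_closedBall (0 : ℂ) ‖z‖).exists_isMinOn ⟨0, by simp⟩ hcont
  have hwz : ‖w‖ ≤ ‖z‖ := by simpa using hw
  have hmin' {v : ℂ} (hv : ‖v‖ ≤ ‖z‖) : (L w).re - K ‖w‖ ≤ (L v).re - K ‖v‖ :=
    hmin (by simpa using hv)
  have hwD : w ∈ disk := mem_disk.mpr (hnorm hwz).2
  have hLw := hL.differentiableAt (disk_mem_nhds hwD)
  have him := im_mul_deriv_eq_zero_of_isMinOn hLw fun v hv => by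
    simpa only [hv, sub_le_sub_iff_right] using hmin' (hv.le.trans hwz)
  have hre := re_mul_deriv_le_of_isMinOn hLw (hK hwz) fun v hv => hmin' (hv.trans hwz)
  have hw0 : w = 0 := by
    by_contra hne
    nlinarith [h w hwD him, mul_pos (norm_pos_iff.mpr hne) hε]
  have hmin_z := hmin' le_rfl
  simp only [hw0, K, norm_zero, mul_zero, sub_zero] at hmin_z
  have : ε * ‖z‖ ≤ ε := mul_le_of_le_one_right hε.le (mem_disk.mp hz).le
  linarith

variable {φ ω f G : ℂ → ℂ} {z : ℂ}

lemma re_comp_schwarz_mem_Icc (hreal : ∀ z ∈ disk, (φ z).im = 0 → z.im = 0)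
    (hmono : MonotoneOn (fun x : ℝ => (φ x).re) (Ioo (-1) 1)) (hω : DifferentiableOn ℂ ω disk)
    (hωm : MapsTo ω disk disk) (h0 : ω 0 = 0) (hw : w ∈ disk) (him : (φ (ω w)).im = 0) :
    (φ (ω w)).re ∈ Icc (φ (-‖w‖ : ℝ)).re (φ (‖w‖ : ℝ)).re := by
  have hωw : ‖ω w‖ ≤ ‖w‖ := Complex.norm_le_norm_of_mapsTo_ball hω
    (fun v hv => ball_subset_closedBall (hωm hv)) h0 (mem_disk.mp hw)
  obtain ⟨x, hx⟩ : ∃ x : ℝ, ω w = x :=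
    ⟨(ω w).re, Complex.ext rfl (hreal _ (hωm hw) him)⟩
  rw [hx, Complex.norm_real, Real.norm_eq_abs] at hωw
  have hw1 := mem_disk.mp hw
  obtain ⟨hx1, hx2⟩ := abs_le.mp hωw
  have hIoo {y : ℝ} (hy1 : -‖w‖ ≤ y) (hy2 : y ≤ ‖w‖) : y ∈ Ioo (-1 : ℝ) 1 :=
    ⟨by linarith, by linarith⟩
  rw [hx]
  exact ⟨hmono (hIoo le_rfl (by linarith)) (hIoo hx1 hx2) hx1,
    hmono (hIoo hx1 hx2) (hIoo (by linarith) le_rfl) hx2⟩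

lemma IsMaMindaLog.hasDerivAt_re_ofReal (hG : IsMaMindaLog φ G) {x : ℝ} (hx : |x| < 1) :
    HasDerivAt (fun x : ℝ => (G x).re) (deriv G x).re x :=
  (hG.differentiableAt (ofReal_mem_disk.mpr hx)).hasDerivAt.real_of_complex

lemma IsMaMindaLog.mul_re_deriv_ofReal (hG : IsMaMindaLog φ G) {x : ℝ} (hx : |x| < 1) :
    x * (deriv G x).re = (φ x).re - 1 := by
  rw [← hG.one_add_mul_deriv x (ofReal_mem_disk.mpr hx), Complex.add_re, Complex.re_ofReal_mul,
    Complex.one_re, add_sub_cancel_left]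

lemma IsMaMindaLog.re_mem_Icc (hG : IsMaMindaLog φ G)
    (hreal : ∀ z ∈ disk, (φ z).im = 0 → z.im = 0)
    (hmono : MonotoneOn (fun x : ℝ => (φ x).re) (Ioo (-1) 1)) (hω : DifferentiableOn ℂ ω disk)
    (hωm : MapsTo ω disk disk) (h0 : ω 0 = 0) (hL : IsMaMindaLog (fun z => φ (ω z)) L)
    (hz : z ∈ disk) : (L z).re ∈ Icc (G (-‖z‖ : ℝ)).re (G (‖z‖ : ℝ)).re := by
  have hφ {w : ℂ} (hw : w ∈ disk) (him : (w * deriv L w).im = 0) :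
      1 + (w * deriv L w).re ∈ Icc (φ (-‖w‖ : ℝ)).re (φ (‖w‖ : ℝ)).re := by
    have heq := hL.one_add_mul_deriv w hw
    have h := re_comp_schwarz_mem_Icc hreal hmono hω hωm h0 hw (by simpa [← heq] using him)
    rwa [← heq, Complex.add_re, Complex.one_re] at h
  have habs {w : ℂ} (hw : w ∈ disk) : |‖w‖| < 1 := by rwa [abs_norm, ← mem_disk]
  have habs' {w : ℂ} (hw : w ∈ disk) : |(-‖w‖)| < 1 := by rw [abs_neg]; exact habs hw
  have hIco {x : ℝ} (hx : x ∈ Ico (0 : ℝ) 1) : |x| < 1 := by rw [abs_of_nonneg hx.1]; exact hx.2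
  constructor
  · refine le_re_of_le_re_mul_deriv (H := fun x => (G (-x : ℝ)).re)
      (H' := fun x => -(deriv G (-x : ℝ)).re) hL.differentiableOn (fun x hx => ?_)
      (by simp [hG.map_zero, hL.map_zero]) (fun w hw him => ?_) hz
    · have hneg : |(-x)| < 1 := by rw [abs_neg]; exact hIco hx
      simpa [Function.comp_def] using (hG.hasDerivAt_re_ofReal hneg).comp x (hasDerivAt_neg x)
    · have := hG.mul_re_deriv_ofReal (habs' hw)
      linarith [(hφ hw him).1]
  · have h := le_re_of_le_re_mul_deriv (L := fun z => -L z) (H := fun x => -(G x).re)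
      (H' := fun x => -(deriv G x).re) hL.differentiableOn.neg
      (fun x hx => (hG.hasDerivAt_re_ofReal (hIco hx)).fun_neg)
      (by simp [hG.map_zero, hL.map_zero]) (fun w hw him => ?_) hz
    · rwa [Complex.neg_re, neg_le_neg_iff] at h
    · simp only [deriv.fun_neg, mul_neg, Complex.neg_im, Complex.neg_re, neg_eq_zero,
        neg_le_neg_iff] at him ⊢
      have := hG.mul_re_deriv_ofReal (habs hw)
      linarith [(hφ hw him).2]

lemma IsMaMindaLog.norm_mem_Icc (hG : IsMaMindaLog φ G) (hf : f ∈ starlikeClass φ)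
    (hreal : ∀ z ∈ disk, (φ z).im = 0 → z.im = 0)
    (hmono : MonotoneOn (fun x : ℝ => (φ x).re) (Ioo (-1) 1)) (hz : z ∈ disk) :
    ‖f z‖ ∈ Icc ‖mulExp G (-‖z‖ : ℝ)‖ ‖mulExp G (‖z‖ : ℝ)‖ := by
  obtain ⟨ω, L, hω, hωm, h0, hL, hfL⟩ := exists_of_mem_starlikeClass hf
  obtain ⟨hlow, hup⟩ := hG.re_mem_Icc hreal hmono hω hωm h0 hL hz
  simp only [hfL hz, norm_mulExp, Complex.norm_real, norm_neg, norm_norm]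
  constructor <;> gcongr

end Growth

section Boundary

variable {f : ℂ → ℂ} {U : Set ℂ}

lemma isOpen_image_of_injOn (hU : IsOpen U) (hf : DifferentiableOn ℂ f U) (hinj : InjOn f U) :
    IsOpen (f '' U) := by
  refine isOpen_iff_mem_nhds.mpr ?_
  rintro _ ⟨z, hz, rfl⟩
  refine (hf.analyticAt (hU.mem_nhds hz)).eventually_constant_or_nhds_le_map_nhds.resolve_left
    (fun hconst => ?_) (image_mem_map (hU.mem_nhds hz))
  obtain ⟨w, ⟨hwz, hw⟩, hne⟩ := (((hconst.and (hU.mem_nhds hz)).filter_mono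
    nhdsWithin_le_nhds).and self_mem_nhdsWithin : ∀ᶠ w in 𝓝[≠] z, _).exists
  exact hne (hinj hw hz hwz)

lemma mem_frontier_image (hU : IsOpen U) (hf : DifferentiableOn ℂ f U) (hinj : InjOn f U) {ζ : ℂ}
    (hζ : ζ ∈ frontier U) (hcont : ContinuousWithinAt f U ζ) : f ζ ∈ frontier (f '' U) := by
  rw [hU.frontier_eq] at hζ
  rw [(isOpen_image_of_injOn hU hf hinj).frontier_eq]
  refine ⟨hcont.mem_closure_image hζ.1, ?_⟩
  rintro ⟨z, hz, hzζ⟩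
  have hne : z ≠ ζ := ne_of_mem_of_not_mem hz hζ.2
  obtain ⟨A, B, hA, hB, hzA, hζB, hAB⟩ := t2_separation hne
  have hnhds : f '' (U ∩ A) ∈ 𝓝 (f ζ) := (isOpen_image_of_injOn (hU.inter hA)
    (hf.mono inter_subset_left) (hinj.mono inter_subset_left)).mem_nhds ⟨z, ⟨hz, hzA⟩, hzζ⟩
  have := mem_closure_iff_nhdsWithin_neBot.mp hζ.1
  obtain ⟨v, ⟨⟨u, ⟨huU, huA⟩, huv⟩, hvB⟩, hvU⟩ := (((hcont.eventually hnhds).and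
    (nhdsWithin_le_nhds (hB.mem_nhds hζB))).and self_mem_nhdsWithin).exists
  exact hAB.notMem_of_mem_left huA (hinj huU hvU huv ▸ hvB)

lemma le_norm_of_mem_frontier_image (hf : ContinuousOn f disk) (hopen : IsOpen (f '' disk))
    {c : ℝ} (hc : 0 ≤ c) (hlow : ∀ z ∈ disk, c * ‖z‖ ≤ ‖f z‖) {w : ℂ}
    (hw : w ∈ frontier (f '' disk)) : c ≤ ‖w‖ := by
  rw [hopen.frontier_eq] at hw
  have hball (ρ : ℝ) (hρ : ρ < 1) : c * ρ ≤ ‖w‖ := by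
    have hsub : closedBall (0 : ℂ) ρ ⊆ disk := closedBall_subset_ball hρ
    have hclosed : IsClosed (f '' closedBall 0 ρ) :=
      ((isCompact_closedBall _ _).image_of_continuousOn (hf.mono hsub)).isClosed
    have hcover : f '' disk ⊆ f '' closedBall 0 ρ ∪ {v | c * ρ ≤ ‖v‖} := by
      rintro _ ⟨z, hz, rfl⟩
      rcases le_total ‖z‖ ρ with h | h
      · exact Or.inl ⟨z, by simpa using h, rfl⟩
      · exact Or.inr ((mul_le_mul_of_nonneg_left h hc).trans (hlow z hz))
    exact (closure_minimal hcover (hclosed.union (isClosed_le continuous_const continuous_norm))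
      hw.1).resolve_left fun h => hw.2 (image_mono hsub h)
  have hlim : Tendsto (fun ρ : ℝ => c * ρ) (𝓝[<] 1) (𝓝 (c * 1)) :=
    ((continuous_const_mul c).tendsto 1).mono_left nhdsWithin_le_nhds
  rw [mul_one] at hlim
  exact le_of_tendsto hlim (eventually_mem_nhdsWithin.mono hball)

lemma le_boundaryDist (hf : f ∈ classS) {c C : ℝ} (hc : 0 ≤ c)
    (hlow : ∀ z ∈ disk, c * ‖z‖ ≤ ‖f z‖) (hup : ∀ z ∈ disk, ‖f z‖ ≤ C) :
    c ≤ boundaryDist f := by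
  obtain ⟨hfd, hinj, hf0, -⟩ := hf
  have hne : (frontier (f '' disk)).Nonempty := by
    refine nonempty_frontier_iff.mpr ⟨⟨f 0, mem_image_of_mem f zero_mem_disk⟩, fun h => ?_⟩
    obtain ⟨w, hw⟩ := NormedSpace.exists_lt_norm ℝ ℂ C
    obtain ⟨z, hz, rfl⟩ := h.symm ▸ mem_univ w
    exact hw.not_ge (hup z hz)
  refine (le_infDist hne).mpr fun w hw => ?_
  rw [hf0, dist_zero_left]
  exact le_norm_of_mem_frontier_image hfd.continuousOn
    (isOpen_image_of_injOn isOpen_disk hfd hinj) hc hlow hw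

lemma boundaryDist_le (hf : f ∈ classS) {ζ : ℂ} (hζ : ‖ζ‖ = 1)
    (hcont : ContinuousWithinAt f disk ζ) : boundaryDist f ≤ ‖f ζ‖ := by
  obtain ⟨hfd, hinj, hf0, -⟩ := hf
  have hζ' : ζ ∈ frontier disk := by rw [disk, frontier_ball _ one_ne_zero]; simpa using hζ
  rw [boundaryDist, hf0, ← dist_zero_left]
  exact infDist_le_dist_of_mem (mem_frontier_image isOpen_disk hfd hinj hζ' hcont)

end Boundary

section Limacon

/-- The exponent of the extremal function `hL s = mulExp (exponentL s)`. -/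
def exponentL (s : ℝ) (z : ℂ) : ℂ := s * (2 * z + s * z ^ 2 / 2)

/-- The restriction of `hL s` to the real axis. -/
def realHL (s x : ℝ) : ℝ := x * Real.exp (s * (2 * x + s * x ^ 2 / 2))

variable {s r : ℝ} {z : ℂ} {f : ℂ → ℂ}

lemma hL_ofReal (s x : ℝ) : hL s x = realHL s x := by simp [hL, realHL]

lemma norm_hL_ofReal (s x : ℝ) : ‖hL s x‖ = |x| * Real.exp (s * (2 * x + s * x ^ 2 / 2)) := by
  rw [hL_ofReal, realHL, Complex.norm_real, Real.norm_eq_abs, abs_mul, Real.abs_exp]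

lemma neg_realHL_neg_one (s : ℝ) :
    -realHL s (-1) = Real.exp (s * (2 * -1 + s * (-1) ^ 2 / 2)) := by
  rw [realHL, neg_one_mul, neg_neg]

lemma hL_add_hL_neg_one_eq_zero_iff :
    hL s r + hL s (-1) = 0 ↔ realHL s r = -realHL s (-1) := by
  rw [← Complex.ofReal_one, ← Complex.ofReal_neg, hL_ofReal, hL_ofReal, ← Complex.ofReal_add,
    Complex.ofReal_eq_zero, eq_neg_iff_add_eq_zero]

lemma continuous_realHL (s : ℝ) : Continuous (realHL s) := by
  unfold realHL
  fun_prop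

lemma strictMonoOn_realHL (hs : 0 ≤ s) : StrictMonoOn (realHL s) (Ici 0) := by
  intro x hx y hy hxy
  have hx0 : 0 ≤ x := hx
  refine mul_lt_mul hxy (Real.exp_le_exp.mpr ?_) (Real.exp_pos _) hy
  gcongr

lemma realHL_exponent_le (hs : 0 ≤ s) (hs1 : s ≤ 1) {x y : ℝ} (hx : -1 ≤ x) (hxy : x ≤ y) :
    s * (2 * x + s * x ^ 2 / 2) ≤ s * (2 * y + s * y ^ 2 / 2) := by
  have hsum : 0 ≤ 2 + s * (x + y) / 2 := by nlinarith
  have : 0 ≤ s * ((y - x) * (2 + s * (x + y) / 2)) := by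
    have := sub_nonneg.mpr hxy
    positivity
  linarith

lemma neg_realHL_neg_one_lt_realHL_third (hs : 0.444981 < s) (hs1 : s < 1) :
    -realHL s (-1) < realHL s (1 / 3) := by
  have hthird : (1 / 3 : ℝ) = Real.exp (-Real.log 3) := by
    rw [Real.exp_neg, Real.exp_log (by norm_num), one_div]
  rw [neg_realHL_neg_one, realHL]
  nth_rewrite 1 [hthird]
  rw [← Real.exp_add, Real.exp_lt_exp]
  nlinarith [Real.log_three_lt_d9, mul_pos (sub_pos.mpr hs) (sub_pos.mpr hs1)]

lemma re_phiL_pos (hs2 : s ^ 2 ≤ 1 / 2) (hz : z ∈ disk) : 0 < (phiL s z).re := by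
  have hnorm : z.re ^ 2 + z.im ^ 2 < 1 := by
    rw [pow_two, pow_two, ← Complex.normSq_apply, Complex.normSq_eq_norm_sq]
    exact pow_lt_one₀ (norm_nonneg z) (mem_disk.mp hz) two_ne_zero
  have hre : (phiL s z).re = (1 + s * z.re) ^ 2 - s ^ 2 * z.im ^ 2 := by
    simp [phiL, sq]
    ring
  rw [hre]
  nlinarith [sq_nonneg (s * z.re + 1 / 2), sq_nonneg s]

lemma im_eq_zero_of_im_phiL_eq_zero (hs : 0 < s) (hs1 : s ≤ 1) (hz : z ∈ disk)
    (h : (phiL s z).im = 0) : z.im = 0 := by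
  have him : (phiL s z).im = 2 * s * (1 + s * z.re) * z.im := by
    simp [phiL, sq]
    ring
  have hre : -1 < z.re := (abs_lt.mp ((Complex.abs_re_le_norm z).trans_lt (mem_disk.mp hz))).1
  have hpos : 0 < 1 + s * z.re := by nlinarith
  exact (mul_eq_zero.mp (him.symm.trans h)).resolve_left (by positivity)

lemma monotoneOn_re_phiL (hs : 0 ≤ s) (hs1 : s ≤ 1) :
    MonotoneOn (fun x : ℝ => (phiL s x).re) (Ioo (-1) 1) := by
  intro x hx y _ hxy
  have hre (t : ℝ) : (phiL s t).re = (1 + s * t) ^ 2 := by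
    rw [phiL]
    exact_mod_cast Complex.ofReal_re _
  have hpos : 0 ≤ 1 + s * x := by nlinarith [hx.1]
  simp only [hre]
  gcongr

lemma hasDerivAt_exponentL (s : ℝ) (z : ℂ) :
    HasDerivAt (exponentL s) (s * (2 + s * z)) z := by
  convert! (((hasDerivAt_id' z).const_mul 2).add
    (((hasDerivAt_pow 2 z).const_mul (s : ℂ)).div_const 2)).const_mul (s : ℂ) using 2
  norm_num
  ring

lemma isMaMindaLog_exponentL (s : ℝ) : IsMaMindaLog (phiL s) (exponentL s) where
  differentiableOn z _ := (hasDerivAt_exponentL s z).differentiableAt.differentiableWithinAt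
  map_zero := by simp [exponentL]
  one_add_mul_deriv z _ := by
    rw [(hasDerivAt_exponentL s z).deriv, phiL]
    ring

lemma hL_mem_classSTL (hs2 : s ^ 2 ≤ 1 / 2) : hL s ∈ classSTL s :=
  (isMaMindaLog_exponentL s).mulExp_mem_starlikeClass fun _ => re_phiL_pos hs2

lemma majorantSum_exponentL (hs : 0 ≤ s) (hr : |r| < 1) :
    majorantSum (exponentL s) r = s * (2 * r + s * r ^ 2 / 2) := by
  have hconst : majorantSum (fun _ => (s ^ 2 / 2 : ℂ)) r = s ^ 2 / 2 := by
    rw [majorantSum, tsum_eq_single 0 fun n hn => ?_]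
    · simp [taylorCoeff_zero]
    · simp [taylorCoeff, iteratedDeriv_const, hn]
  have heq : exponentL s = fun z : ℂ => 0 + z * (2 * s + z * (s ^ 2 / 2)) := by
    funext z
    rw [exponentL]
    ring
  have hlin : Differentiable ℂ fun z : ℂ => 2 * s + z * (s ^ 2 / 2 : ℂ) := by fun_prop
  rw [heq, majorantSum_const_add_id_mul 0 (hlin.analyticAt 0)
      (summable_norm_taylorCoeff hlin.differentiableOn hr),
    majorantSum_const_add_id_mul _ analyticAt_const
      (summable_norm_taylorCoeff (differentiableOn_const _) hr), hconst]
  simp [abs_of_nonneg hs]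
  ring

lemma majorant_le_realHL (hs : 0 ≤ s) (hf : f ∈ classSTL s) (hr : 0 ≤ r) (hr3 : r ≤ 1 / 3) :
    majorant f r ≤ realHL s r := by
  rw [realHL, ← majorantSum_exponentL hs (by rw [abs_of_nonneg hr]; linarith)]
  exact (isMaMindaLog_exponentL s).majorant_le hf hr hr3

lemma realHL_le_majorant (hs2 : s ^ 2 ≤ 1 / 2) (hr : 0 ≤ r) (hr1 : r < 1) :
    realHL s r ≤ majorant (hL s) r := by
  have hr' : |r| < 1 := by rwa [abs_of_nonneg hr]
  have hS := (hL_mem_classSTL hs2).1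
  have h := norm_le_majorantSum hS.1 (ofReal_mem_disk.mpr hr')
  rw [Complex.norm_of_nonneg hr, norm_hL_ofReal, abs_of_nonneg hr] at h
  rwa [majorant_eq_majorantSum hS hr']

lemma neg_realHL_neg_one_le_boundaryDist (hs : 0 < s) (hs1 : s ≤ 1) (hf : f ∈ classSTL s) :
    -realHL s (-1) ≤ boundaryDist f := by
  have hgrowth (z : ℂ) (hz : z ∈ disk) : ‖f z‖ ∈ Icc ‖hL s (-‖z‖ : ℝ)‖ ‖hL s (‖z‖ : ℝ)‖ :=
    (isMaMindaLog_exponentL s).norm_mem_Icc hf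
      (fun _ => im_eq_zero_of_im_phiL_eq_zero hs hs1) (monotoneOn_re_phiL hs.le hs1) hz
  simp only [norm_hL_ofReal, abs_neg, abs_norm] at hgrowth
  rw [neg_realHL_neg_one]
  refine le_boundaryDist (C := realHL s 1) hf.1 (Real.exp_pos _).le (fun z hz => ?_)
    fun z hz => ?_
  · rw [mul_comm]
    refine le_trans (mul_le_mul_of_nonneg_left (Real.exp_le_exp.mpr ?_) (norm_nonneg z))
      (hgrowth z hz).1
    exact realHL_exponent_le hs.le hs1 le_rfl (neg_le_neg (mem_disk.mp hz).le)
  · exact (hgrowth z hz).2.trans ((strictMonoOn_realHL hs.le).monotoneOn (norm_nonneg z)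
      (mem_Ici.mpr zero_le_one) (mem_disk.mp hz).le)

lemma boundaryDist_hL_le (hs2 : s ^ 2 ≤ 1 / 2) : boundaryDist (hL s) ≤ -realHL s (-1) := by
  have hcont : Continuous (hL s) := by
    unfold hL
    fun_prop
  refine (boundaryDist_le (ζ := (-1 : ℝ)) (hL_mem_classSTL hs2).1 (by simp)
    hcont.continuousWithinAt).trans_eq ?_
  rw [norm_hL_ofReal, neg_realHL_neg_one, abs_neg, abs_one, one_mul]

lemma exists_realHL_eq (hs : 0.444981 < s) (hs1 : s < 1) :
    ∃ rf ∈ Ioo (0 : ℝ) (1 / 3), realHL s rf = -realHL s (-1) := by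
  refine intermediate_value_Ioo (by norm_num) (continuous_realHL s).continuousOn
    ⟨?_, neg_realHL_neg_one_lt_realHL_third hs hs1⟩
  simp [realHL, Real.exp_pos]

variable {rf : ℝ}

lemma isLeast_root (hs : 0 ≤ s) (hrf : rf ∈ Ioo (0 : ℝ) 1) (heq : realHL s rf = -realHL s (-1)) :
    IsLeast {r : ℝ | r ∈ Ioo (0 : ℝ) 1 ∧ hL s r + hL s (-1) = 0} rf := by
  refine ⟨⟨hrf, hL_add_hL_neg_one_eq_zero_iff.mpr heq⟩, fun r hr => ?_⟩
  have hroot := hL_add_hL_neg_one_eq_zero_iff.mp hr.2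
  exact ((strictMonoOn_realHL hs).injOn hrf.1.le hr.1.1.le (heq.trans hroot.symm)).le

lemma majorant_le_boundaryDist (hs : 0 < s) (hs1 : s ≤ 1) (hrf : rf ≤ 1 / 3)
    (heq : realHL s rf = -realHL s (-1)) (hf : f ∈ classSTL s) (hr : 0 ≤ r) (hrrf : r ≤ rf) :
    majorant f r ≤ boundaryDist f :=
  calc majorant f r ≤ realHL s r := majorant_le_realHL hs.le hf hr (hrrf.trans hrf)
    _ ≤ realHL s rf := (strictMonoOn_realHL hs.le).monotoneOn hr (hr.trans hrrf) hrrf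
    _ = -realHL s (-1) := heq
    _ ≤ boundaryDist f := neg_realHL_neg_one_le_boundaryDist hs hs1 hf

lemma boundaryDist_hL_lt_majorant (hs : 0 ≤ s) (hs2 : s ^ 2 ≤ 1 / 2) (hrf : 0 ≤ rf)
    (heq : realHL s rf = -realHL s (-1)) (hr : rf < r) (hr1 : r < 1) :
    boundaryDist (hL s) < majorant (hL s) r :=
  calc boundaryDist (hL s) ≤ -realHL s (-1) := boundaryDist_hL_le hs2
    _ = realHL s rf := heq.symm
    _ < realHL s r := strictMonoOn_realHL hs hrf (hrf.trans hr.le) hr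
    _ ≤ majorant (hL s) r := realHL_le_majorant hs2 (hrf.trans hr.le) hr1

end Limacon

end BohrStarlike

end

theorem corollary2p9 (s : ℝ) (hs : 0.444981 < s) (hs' : s ≤ 1 / Real.sqrt 2) :
    -- `h` is the Ma-Minda extremal function of the class: `h ∈ 𝒮` and `z h'(z) / h(z) = φ(z)`
    (BohrStarlike.hL s ∈ BohrStarlike.classSTL s ∧
      ∀ z ∈ BohrStarlike.disk, BohrStarlike.logDerivQuot (BohrStarlike.hL s) z =
        BohrStarlike.phiL s z) ∧
    ∃ rf : ℝ,
      -- `rf` is the smallest root in `(0, 1)` of `h(r) + h(-1) = 0`, and `rf < 1/3`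
      IsLeast {r : ℝ | r ∈ Set.Ioo (0 : ℝ) 1 ∧
        BohrStarlike.hL s (r : ℂ) + BohrStarlike.hL s (-1) = 0} rf ∧
      rf < 1 / 3 ∧
      -- the Bohr inequality holds for `|z| ≤ rf`
      (∀ f ∈ BohrStarlike.classSTL s, ∀ z : ℂ, ‖z‖ ≤ rf →
        Summable (fun n : ℕ => ‖BohrStarlike.taylorCoeff f (n + 2)‖ * ‖z‖ ^ (n + 2)) ∧
        BohrStarlike.majorant f ‖z‖ ≤ BohrStarlike.boundaryDist f) ∧
      -- `rf` cannot be replaced by any larger radius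
      (∀ r : ℝ, rf < r → r < 1 → ∃ f ∈ BohrStarlike.classSTL s, ∀ z : ℂ, ‖z‖ = r →
        Summable (fun n : ℕ => ‖BohrStarlike.taylorCoeff f (n + 2)‖ * ‖z‖ ^ (n + 2)) ∧
        BohrStarlike.boundaryDist f < BohrStarlike.majorant f ‖z‖) := by
  have hs0 : 0 < s := lt_trans (by norm_num) hs
  have hs2 : s ^ 2 ≤ 1 / 2 := by
    calc s ^ 2 ≤ (1 / Real.sqrt 2) ^ 2 := by gcongr
      _ = 1 / 2 := by rw [div_pow, one_pow, Real.sq_sqrt zero_le_two]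
  have hs1 : s < 1 := by nlinarith
  have hmem := BohrStarlike.hL_mem_classSTL hs2
  refine ⟨⟨hmem, fun z hz => (BohrStarlike.isMaMindaLog_exponentL s).logDerivQuot_eq hz⟩, ?_⟩
  obtain ⟨rf, ⟨hrf0, hrf3⟩, hrf⟩ := BohrStarlike.exists_realHL_eq hs hs1
  refine ⟨rf, BohrStarlike.isLeast_root hs0.le ⟨hrf0, by linarith⟩ hrf, hrf3,
    fun f hf z hz => ⟨?_, ?_⟩, fun r hr hr1 => ⟨BohrStarlike.hL s, hmem, ?_⟩⟩
  · exact BohrStarlike.summable_majorant hf.1 (by rw [abs_norm]; linarith)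
  · exact BohrStarlike.majorant_le_boundaryDist hs0 hs1.le hrf3.le hrf hf (norm_nonneg z) hz
  · rintro z rfl
    exact ⟨BohrStarlike.summable_majorant hmem.1 (by rwa [abs_norm]),
      BohrStarlike.boundaryDist_hL_lt_majorant hs0.le hs2 hrf0.le hrf hr hr1⟩
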